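/- Let $G$ be a finite connected undirected graph without loops on a node set $\mathcal N$ with at least two nodes, in which every link $\{i,j\}$ carries a weight $c_{ij}=c_{ji}>0$; put $c_{ij}=0$ if $i$ and $j$ are not linked. Let $k_i=\sum_j c_{ij}$ be the (weighted) degrees and $m=\tfrac12\sum_i k_i$. Let $Q$ be the Laplacian matrix, $Q_{ii}=k_i$ and $Q_{ij}=-c_{ij}$ for $i\neq j$, let $Q^\dagger$ be its Moore–Penrose pseudoinverse, and let $\omega_{ij}=(e_i-e_j)^TQ^\dagger(e_i-e_j)$ be the effective resistance between $i$ and $j$, where $e_i$ are the unit vectors. The variance of a distribution $p$ on $\mathcal N$ with respect to the square-root effective resistance $\sqrt{\omega}$ is $$\operatorname{var}_\omega(p)=\frac12\sum_{i,j\in\mathcal N}p(i)\,p(j)\,\bigl(\sqrt{\omega_{ij}}\bigr)^2 .$$ Consider the random walk $(N_t)_{t\ge 0}$ on $G$, the Markov chain with $\Pr(N_{t+1}=j\mid N_t=i)=T_{ji}=c_{ij}/k_i$. Then the distribution $\pi(i)=k_i/(2m)$ is the unique stationary distribution of the walk, that is, the unique probability distribution $p$ on $\mathcal N$ with $Tp=p$.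 Moreover, for a node $i$ let $\kappa_i=\mathbb E\bigl[\min\{t\ge 0: N_t=J\}\bigr]$ be the expected time at which the walk started at $N_0=i$ first reaches a random node $J\sim\pi$ that is independent of the walk. Then $\kappa_i$ is finite, it does not depend on $i$, and its common value $\kappa$ (Kemeny's constant) satisfies $$\kappa = 2m\operatorname{var}_\omega(\pi).$$ -/

import Mathlib

/-!
For a target `j`, the expected hitting times `h i` of `j` are determined by `h j = 0` and the
one-step equation `h i = 1 + ∑ y, T y i * h y` for `i ≠ j`. Multiplied by `k i` this says that
`Q h` and the degree vector agree off `j`, so `Q h = 2m (π - e_j)` because the entries of `Q h` sum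
to zero; since `ker Q` consists of the constants, `h i = 2m (e_i - e_j)ᵀ Q† (π - e_j)`.

Two identities can be read off this formula. The commute time `h_j i + h_i j` is `2m ω i j`, and
the `π`-average of `h_j i` over the target `j` does not depend on `i`, as `∑ j, π j (π - e_j) = 0`.
Averaging also over `i ∼ π` and symmetrizing, `κ = ½ ∑ i j, π i π j (2m ω i j)`.
-/

open MeasureTheory ProbabilityTheory Matrix
open scoped ENNReal

/-- The four Penrose conditions: `X` is a Moore-Penrose pseudoinverse of the real matrix `A`. -/
structure IsMoorePenroseInverse {V : Type*} [Fintype V] (A X : Matrix V V ℝ) : Prop where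
  mul_mul_self : A * X * A = A
  self_mul_mul : X * A * X = X
  symm_left : (A * X)ᵀ = A * X
  symm_right : (X * A)ᵀ = X * A

/-- A Moore-Penrose pseudoinverse is unique. -/
theorem IsMoorePenroseInverse.unique {V : Type*} [Fintype V] {A X Y : Matrix V V ℝ}
    (hX : IsMoorePenroseInverse A X) (hY : IsMoorePenroseInverse A Y) : X = Y := by
  have h1 : A * X = A * Y := by
    calc A * X = (A * X)ᵀ := hX.symm_left.symm
      _ = ((A * Y) * (A * X))ᵀ := by rw [← Matrix.mul_assoc (A * Y) A X, hY.mul_mul_self]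
      _ = (A * X) * (A * Y) := by rw [Matrix.transpose_mul, hX.symm_left, hY.symm_left]
      _ = A * Y := by rw [← Matrix.mul_assoc (A * X) A Y, hX.mul_mul_self]
  have h2 : X * A = Y * A := by
    calc X * A = (X * A)ᵀ := hX.symm_right.symm
      _ = ((X * A) * (Y * A))ᵀ := by
          rw [Matrix.mul_assoc X A (Y * A), ← Matrix.mul_assoc A Y A, hY.mul_mul_self]
      _ = (Y * A) * (X * A) := by rw [Matrix.transpose_mul, hX.symm_right, hY.symm_right]
      _ = Y * A := by rw [Matrix.mul_assoc Y A (X * A), ← Matrix.mul_assoc A X A, hX.mul_mul_self]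
  calc X = X * A * X := hX.self_mul_mul.symm
    _ = Y * A * X := by rw [h2]
    _ = Y * A * Y := by rw [Matrix.mul_assoc, h1, ← Matrix.mul_assoc]
    _ = Y := hY.self_mul_mul

/-- A real symmetric matrix has a Moore-Penrose pseudoinverse. -/
theorem exists_isMoorePenroseInverse {V : Type*} [Fintype V] [DecidableEq V]
    {A : Matrix V V ℝ} (hA : A.IsSymm) : ∃ X, IsMoorePenroseInverse A X := by
  have hH : A.IsHermitian := by
    rw [Matrix.IsHermitian, Matrix.conjTranspose_eq_transpose_of_trivial]; exact hA
  obtain ⟨U, d, hU, hAd⟩ : ∃ (U : Matrix V V ℝ) (d : V → ℝ),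
      Uᵀ * U = 1 ∧ A = U * diagonal d * Uᵀ := by
    refine ⟨hH.eigenvectorUnitary, hH.eigenvalues, ?_, ?_⟩
    · have h := Unitary.coe_star_mul_self hH.eigenvectorUnitary
      rwa [Matrix.star_eq_conjTranspose, Matrix.conjTranspose_eq_transpose_of_trivial] at h
    · have h := hH.spectral_theorem
      rw [Unitary.conjStarAlgAut_apply, Matrix.star_eq_conjTranspose,
        Matrix.conjTranspose_eq_transpose_of_trivial] at h
      exact h
  have key : ∀ a b : V → ℝ, (U * diagonal a * Uᵀ) * (U * diagonal b * Uᵀ)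
      = U * diagonal (fun i => a i * b i) * Uᵀ := by
    intro a b
    calc (U * diagonal a * Uᵀ) * (U * diagonal b * Uᵀ)
        = U * diagonal a * (Uᵀ * U) * diagonal b * Uᵀ := by simp only [Matrix.mul_assoc]
      _ = U * (diagonal a * diagonal b) * Uᵀ := by
          rw [hU, Matrix.mul_one, Matrix.mul_assoc U]
      _ = _ := by rw [Matrix.diagonal_mul_diagonal]
  have keyT : ∀ a : V → ℝ, (U * diagonal a * Uᵀ)ᵀ = U * diagonal a * Uᵀ := by
    intro a
    simp only [Matrix.transpose_mul, Matrix.transpose_transpose, Matrix.diagonal_transpose,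
      Matrix.mul_assoc]
  subst hAd
  refine ⟨U * diagonal (fun i => (d i)⁻¹) * Uᵀ, ⟨?_, ?_, ?_, ?_⟩⟩
  · rw [key, key]; congr; funext i; exact mul_inv_mul_cancel (d i)
  · rw [key, key]; congr; funext i
    by_cases h : d i = 0
    · simp [h]
    · field_simp
  · rw [key, keyT]
  · rw [key, keyT]

open scoped Classical in
/-- The Moore-Penrose pseudoinverse `A†` of a real square matrix. -/
noncomputable def moorePenroseInverse {V : Type*} [Fintype V] (A : Matrix V V ℝ) :
    Matrix V V ℝ :=
  if h : ∃ X, IsMoorePenroseInverse A X then h.choose else 0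

/-- For symmetric matrices the pseudoinverse satisfies the Penrose conditions. -/
theorem moorePenroseInverse_spec {V : Type*} [Fintype V] [DecidableEq V]
    {A : Matrix V V ℝ} (hA : A.IsSymm) : IsMoorePenroseInverse A (moorePenroseInverse A) := by
  have h := exists_isMoorePenroseInverse hA
  rw [moorePenroseInverse, dif_pos h]
  exact h.choose_spec

/-- The variance `½ ∑ i j, p i * p j * d(i, j)²` of a distribution `p` with respect to a
distance function `d`. -/
noncomputable def graphVariance {V : Type*} [Fintype V] (d : V → V → ℝ) (p : V → ℝ) : ℝ :=
  (1 / 2) * ∑ i, ∑ j, p i * p j * d i j ^ 2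

/-- The first time `t ≥ 0` at which the trajectory `x` is at the node `j` (`⊤` if there is none). -/
noncomputable def hittingTime {V : Type*} (x : ℕ → V) (j : V) : ℕ∞ :=
  hittingAfter (fun (t : ℕ) (y : ℕ → V) => y t) {j} 0 x

/-- A connected (undirected) graph with a positive weight on every link. -/
structure WeightedGraph (V : Type*) where
  /-- the links of the graph -/
  links : SimpleGraph V
  connected : links.Connected
  /-- the weights `c i j`, extended by zero to pairs of nodes that are not linked -/
  weight : V → V → ℝ
  weight_symm : ∀ i j, weight i j = weight j i
  weight_pos : ∀ i j, links.Adj i j → 0 < weight i j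
  weight_eq_zero : ∀ i j, ¬ links.Adj i j → weight i j = 0

namespace WeightedGraph

theorem weight_nonneg {V : Type*} (G : WeightedGraph V) (i j : V) : 0 ≤ G.weight i j := by
  by_cases h : G.links.Adj i j
  · exact (G.weight_pos i j h).le
  · exact (G.weight_eq_zero i j h).ge

variable {V : Type*} [Fintype V]

/-- The weighted degree `k i = ∑ j, c i j`. -/
noncomputable def degree (G : WeightedGraph V) (i : V) : ℝ := ∑ j, G.weight i j

/-- The total weight `m = ½ ∑ i, k i` of the links. -/
noncomputable def totalWeight (G : WeightedGraph V) : ℝ := (1 / 2) * ∑ i, G.degree i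

/-- The Laplacian matrix `Q`. -/
noncomputable def laplacian [DecidableEq V] (G : WeightedGraph V) : Matrix V V ℝ :=
  Matrix.of fun i j => if i = j then G.degree i else - G.weight i j

/-- The effective resistance `ω i j = (e_i - e_j)ᵀ Q† (e_i - e_j)`. -/
noncomputable def effectiveResistance [DecidableEq V] (G : WeightedGraph V) (i j : V) : ℝ :=
  (Pi.single i 1 - Pi.single j 1) ⬝ᵥ
    (moorePenroseInverse G.laplacian *ᵥ (Pi.single i 1 - Pi.single j 1))

/-- The variance with respect to the square root effective resistance. -/
noncomputable def resistanceVariance [DecidableEq V] (G : WeightedGraph V) (p : V → ℝ) : ℝ :=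
  graphVariance (fun i j => Real.sqrt (G.effectiveResistance i j)) p

/-- The transition matrix of the random walk, `T j i = c i j / k i`, the probability of a step
from `i` to `j`. -/
noncomputable def transitionMatrix (G : WeightedGraph V) : Matrix V V ℝ :=
  Matrix.of fun j i => G.weight i j / G.degree i

/-- A probability distribution `p` with `T p = p`. -/
def IsStationary (G : WeightedGraph V) (p : V → ℝ) : Prop :=
  p ∈ stdSimplex ℝ V ∧ G.transitionMatrix *ᵥ p = p

/-- The distribution `π i = k i / (2 m)`. -/
noncomputable def stationary (G : WeightedGraph V) (i : V) : ℝ :=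
  G.degree i / (2 * G.totalWeight)

theorem degree_pos [Nontrivial V] (G : WeightedGraph V) (i : V) : 0 < G.degree i := by
  obtain ⟨j, hj⟩ := G.connected.preconnected.exists_adj_of_nontrivial i
  exact Finset.sum_pos' (fun j _ => G.weight_nonneg i j)
    ⟨j, Finset.mem_univ j, G.weight_pos i j hj⟩

variable [MeasurableSpace V] [DiscreteMeasurableSpace V]

/-- The Markov kernel of one step of the random walk: from `i` move to `j` with probability
`T j i`. -/
noncomputable def stepKernel (G : WeightedGraph V) : Kernel V V where
  toFun i := ∑ j, ENNReal.ofReal (G.transitionMatrix j i) • Measure.dirac j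
  measurable' := Measurable.of_discrete

instance [Nontrivial V] (G : WeightedGraph V) : IsMarkovKernel G.stepKernel where
  isProbabilityMeasure i := by
    constructor
    change (∑ j, ENNReal.ofReal (G.transitionMatrix j i) • Measure.dirac j : Measure V)
      Set.univ = 1
    have h0 := (G.degree_pos i).ne'
    simp only [Measure.coe_finsetSum, Measure.coe_smul, Finset.sum_apply, Pi.smul_apply,
      measure_univ, smul_eq_mul, mul_one, transitionMatrix, Matrix.of_apply]
    rw [← ENNReal.ofReal_sum_of_nonneg
      fun j _ => div_nonneg (G.weight_nonneg i j) (G.degree_pos i).le, ← Finset.sum_div]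
    simp only [degree] at h0 ⊢
    rw [div_self h0, ENNReal.ofReal_one]

/-- The law, on the space of trajectories `ℕ → V`, of the random walk started at the node `i`:
the first node is `i`, and given the trajectory up to time `n` the node at time `n + 1` is
distributed according to the step kernel at the node at time `n`. -/
noncomputable def walkLaw [Nontrivial V] (G : WeightedGraph V) (i : V) : Measure (ℕ → V) :=
  Kernel.trajMeasure (X := fun _ => V) (Measure.dirac i) fun n =>
    G.stepKernel.comap (fun h : (Finset.Iic n → V) => h ⟨n, Finset.mem_Iic.2 le_rfl⟩)
      (measurable_pi_apply _)

/-- The law of a random node `J ∼ π`. -/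
noncomputable def stationaryLaw (G : WeightedGraph V) : Measure V :=
  ∑ j, ENNReal.ofReal (G.stationary j) • Measure.dirac j

/-- The expected time `κ_i` which the random walk started at `i` takes to reach a random node `J`
that is independent of the walk and has law `π`. -/
noncomputable def kemenyTime [Nontrivial V] (G : WeightedGraph V) (i : V) : ℝ≥0∞ :=
  ∫⁻ z : (ℕ → V) × V, (hittingTime z.1 z.2 : ℝ≥0∞) ∂((G.walkLaw i).prod G.stationaryLaw)

end WeightedGraph

section PseudoInverse

variable {V : Type*} [Fintype V] {A X : Matrix V V ℝ}

theorem IsMoorePenroseInverse.transpose (h : IsMoorePenroseInverse A X) :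
    IsMoorePenroseInverse Aᵀ Xᵀ where
  mul_mul_self := by
    simpa only [Matrix.transpose_mul, Matrix.mul_assoc] using
      congrArg Matrix.transpose h.mul_mul_self
  self_mul_mul := by
    simpa only [Matrix.transpose_mul, Matrix.mul_assoc] using
      congrArg Matrix.transpose h.self_mul_mul
  symm_left := by rw [← Matrix.transpose_mul, h.symm_right, h.symm_right]
  symm_right := by rw [← Matrix.transpose_mul, h.symm_left, h.symm_left]

theorem IsMoorePenroseInverse.isSymm (h : IsMoorePenroseInverse A X) (hA : A.IsSymm) :
    X.IsSymm := by
  have hT := h.transpose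
  rw [hA.eq] at hT
  exact hT.unique h

theorem IsMoorePenroseInverse.posSemidef (h : IsMoorePenroseInverse A X) (hA : A.PosSemidef) :
    X.PosSemidef := by
  have hX : Xᴴ = X := by
    rw [conjTranspose_eq_transpose_of_trivial]
    exact h.isSymm (by simpa using hA.isHermitian)
  have hXAX := hA.conjTranspose_mul_mul_same X
  rwa [hX, h.self_mul_mul] at hXAX

theorem IsMoorePenroseInverse.transpose_mul_mul (h : IsMoorePenroseInverse A X) :
    Aᵀ * (A * X) = Aᵀ := by
  rw [← h.symm_left, ← Matrix.transpose_mul, h.mul_mul_self]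

/-- `A X` is the orthogonal projection onto the range of `A`, the orthogonal complement of the
kernel of `Aᵀ`. -/
theorem IsMoorePenroseInverse.mulVec_mulVec_of_dotProduct_eq_zero (h : IsMoorePenroseInverse A X)
    {w : V → ℝ} (hw : ∀ v, Aᵀ *ᵥ v = 0 → w ⬝ᵥ v = 0) : A *ᵥ (X *ᵥ w) = w := by
  set r := w - A *ᵥ (X *ᵥ w)
  have hAr : Aᵀ *ᵥ r = 0 := by
    rw [Matrix.mulVec_sub, Matrix.mulVec_mulVec, Matrix.mulVec_mulVec, Matrix.mul_assoc,
      h.transpose_mul_mul, sub_self]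
  have hrr : r ⬝ᵥ r = 0 := by
    calc r ⬝ᵥ r = w ⬝ᵥ r - X *ᵥ w ⬝ᵥ Aᵀ *ᵥ r := by
          rw [Matrix.dotProduct_mulVec, Matrix.vecMul_transpose, ← sub_dotProduct]
      _ = 0 := by rw [hw r hAr, hAr, dotProduct_zero, sub_zero]
  exact (sub_eq_zero.1 (dotProduct_self_eq_zero.1 hrr)).symm

end PseudoInverse

namespace WeightedGraph

section Laplacian

variable {V : Type*} [Fintype V] [DecidableEq V] (G : WeightedGraph V)

theorem laplacian_eq_diagonal_sub : G.laplacian = diagonal G.degree - Matrix.of G.weight := by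
  ext i j
  by_cases h : i = j
  · subst h
    simp [laplacian, G.weight_eq_zero i i G.links.irrefl]
  · simp [laplacian, h]

theorem laplacian_isSymm : G.laplacian.IsSymm := by
  rw [laplacian_eq_diagonal_sub]
  exact (Matrix.isSymm_diagonal _).sub (Matrix.IsSymm.ext fun i j => G.weight_symm j i)

theorem laplacian_mulVec_apply (f : V → ℝ) (i : V) :
    (G.laplacian *ᵥ f) i = ∑ j, G.weight i j * (f i - f j) := by
  rw [laplacian_eq_diagonal_sub, Matrix.sub_mulVec, Pi.sub_apply, Matrix.mulVec_diagonal]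
  simp only [mul_sub, Finset.sum_sub_distrib, ← Finset.sum_mul]
  rfl

theorem dotProduct_laplacian_mulVec (f : V → ℝ) :
    f ⬝ᵥ (G.laplacian *ᵥ f) = (1 / 2) * ∑ i, ∑ j, G.weight i j * (f i - f j) ^ 2 := by
  have hexpand : f ⬝ᵥ (G.laplacian *ᵥ f) = ∑ i, ∑ j, G.weight i j * (f i * (f i - f j)) := by
    simp only [dotProduct, laplacian_mulVec_apply, Finset.mul_sum, mul_left_comm]
  have hswap : f ⬝ᵥ (G.laplacian *ᵥ f) = ∑ i, ∑ j, G.weight i j * (f j * (f j - f i)) := by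
    rw [hexpand, Finset.sum_comm]
    simp only [G.weight_symm]
  have hadd : f ⬝ᵥ (G.laplacian *ᵥ f) + f ⬝ᵥ (G.laplacian *ᵥ f)
      = ∑ i, ∑ j, G.weight i j * (f i - f j) ^ 2 := by
    nth_rewrite 1 [hexpand]
    rw [hswap]
    simp only [← Finset.sum_add_distrib]
    exact Finset.sum_congr rfl fun i _ => Finset.sum_congr rfl fun j _ => by ring
  linarith

theorem laplacian_posSemidef : G.laplacian.PosSemidef := by
  refine .of_dotProduct_mulVec_nonneg (by simpa using G.laplacian_isSymm) fun f => ?_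
  rw [star_trivial, dotProduct_laplacian_mulVec]
  exact mul_nonneg one_half_pos.le (Finset.sum_nonneg fun i _ => Finset.sum_nonneg fun j _ =>
    mul_nonneg (G.weight_nonneg i j) (sq_nonneg _))

theorem laplacian_mulVec_eq_zero_iff {f : V → ℝ} :
    G.laplacian *ᵥ f = 0 ↔ ∀ i j, f i = f j := by
  refine ⟨fun hf => ?_, fun hf => ?_⟩
  · have hnonneg : ∀ i j, 0 ≤ G.weight i j * (f i - f j) ^ 2 := fun i j =>
      mul_nonneg (G.weight_nonneg i j) (sq_nonneg _)
    have henergy : ∑ i, ∑ j, G.weight i j * (f i - f j) ^ 2 = 0 := by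
      have h := G.dotProduct_laplacian_mulVec f
      rw [hf, dotProduct_zero] at h
      linarith
    have hadj : ∀ i j, G.links.Adj i j → f i = f j := by
      intro i j hij
      have hi := (Finset.sum_eq_zero_iff_of_nonneg fun i _ =>
        Finset.sum_nonneg fun j _ => hnonneg i j).1 henergy i (Finset.mem_univ i)
      have hj := (Finset.sum_eq_zero_iff_of_nonneg fun j _ => hnonneg i j).1 hi j
        (Finset.mem_univ j)
      have hsq := (mul_eq_zero.1 hj).resolve_left (G.weight_pos i j hij).ne'
      exact sub_eq_zero.1 (pow_eq_zero_iff two_ne_zero |>.1 hsq)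
    intro i j
    obtain ⟨walk⟩ := G.connected.preconnected i j
    induction walk with
    | nil => rfl
    | cons h _ ih => exact (hadj _ _ h).trans ih
  · ext i
    rw [laplacian_mulVec_apply]
    exact Finset.sum_eq_zero fun j _ => by rw [hf i j, sub_self, mul_zero]

theorem laplacian_mulVec_moorePenroseInverse_mulVec {w : V → ℝ} (hw : ∑ i, w i = 0) :
    G.laplacian *ᵥ (moorePenroseInverse G.laplacian *ᵥ w) = w := by
  refine (moorePenroseInverse_spec G.laplacian_isSymm).mulVec_mulVec_of_dotProduct_eq_zero
    fun v hv => ?_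
  rw [G.laplacian_isSymm.eq, laplacian_mulVec_eq_zero_iff] at hv
  obtain ⟨i₀⟩ := G.connected.nonempty
  simp only [dotProduct, hv _ i₀, ← Finset.sum_mul, hw, zero_mul]

theorem effectiveResistance_nonneg (i j : V) : 0 ≤ G.effectiveResistance i j :=
  ((moorePenroseInverse_spec G.laplacian_isSymm).posSemidef
    G.laplacian_posSemidef).dotProduct_mulVec_nonneg (Pi.single i 1 - Pi.single j 1)

theorem resistanceVariance_eq (p : V → ℝ) :
    G.resistanceVariance p = (1 / 2) * ∑ i, ∑ j, p i * p j * G.effectiveResistance i j := by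
  simp only [resistanceVariance, graphVariance, Real.sq_sqrt (G.effectiveResistance_nonneg _ _)]

end Laplacian

section Stationary

variable {V : Type*} [Fintype V] [Nontrivial V] (G : WeightedGraph V)

theorem totalWeight_pos : 0 < G.totalWeight :=
  mul_pos one_half_pos (Finset.sum_pos (fun i _ => G.degree_pos i) Finset.univ_nonempty)

theorem stationary_nonneg (i : V) : 0 ≤ G.stationary i :=
  div_nonneg (G.degree_pos i).le (mul_pos two_pos G.totalWeight_pos).le

theorem two_mul_totalWeight_mul_stationary (i : V) :
    2 * G.totalWeight * G.stationary i = G.degree i :=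
  mul_div_cancel₀ _ (mul_pos two_pos G.totalWeight_pos).ne'

theorem sum_stationary : ∑ i, G.stationary i = 1 := by
  have hsum : ∑ i, G.degree i = 2 * G.totalWeight := by rw [totalWeight]; ring
  simp only [stationary, ← Finset.sum_div, hsum]
  exact div_self (mul_pos two_pos G.totalWeight_pos).ne'

theorem transitionMatrix_nonneg (i j : V) : 0 ≤ G.transitionMatrix j i :=
  div_nonneg (G.weight_nonneg i j) (G.degree_pos i).le

theorem sum_transitionMatrix (i : V) : ∑ j, G.transitionMatrix j i = 1 := by
  simp only [transitionMatrix, Matrix.of_apply, ← Finset.sum_div]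
  exact div_self (G.degree_pos i).ne'

theorem degree_mul_transitionMatrix (i j : V) :
    G.degree i * G.transitionMatrix j i = G.weight i j :=
  mul_div_cancel₀ _ (G.degree_pos i).ne'

theorem laplacian_mulVec_eq_degree_mul [DecidableEq V] (f : V → ℝ) (i : V) :
    (G.laplacian *ᵥ f) i = G.degree i * (f i - ∑ y, G.transitionMatrix y i * f y) := by
  simp only [laplacian_mulVec_apply, mul_sub, Finset.sum_sub_distrib, Finset.mul_sum, ← mul_assoc,
    degree_mul_transitionMatrix, ← Finset.sum_mul]
  rfl

theorem laplacian_mulVec_div_degree [DecidableEq V] (p : V → ℝ) :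
    G.laplacian *ᵥ (fun i => p i / G.degree i) = p - G.transitionMatrix *ᵥ p := by
  ext i
  rw [laplacian_mulVec_apply]
  simp only [mul_sub, Finset.sum_sub_distrib, ← Finset.sum_mul]
  refine congrArg₂ (· - ·) (mul_div_cancel₀ _ (G.degree_pos i).ne')
    (Finset.sum_congr rfl fun j _ => ?_)
  change G.weight i j * (p j / G.degree j) = G.weight j i / G.degree j * p j
  rw [G.weight_symm i j]
  ring

theorem transitionMatrix_mulVec_eq_self_iff {p : V → ℝ} :
    G.transitionMatrix *ᵥ p = p ↔ ∃ c, ∀ i, p i = c * G.degree i := by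
  classical
  rw [eq_comm, ← sub_eq_zero, ← laplacian_mulVec_div_degree, laplacian_mulVec_eq_zero_iff]
  refine ⟨fun h => ?_, ?_⟩
  · obtain ⟨i₀⟩ := G.connected.nonempty
    exact ⟨p i₀ / G.degree i₀, fun i => (div_eq_iff (G.degree_pos i).ne').1 (h i i₀)⟩
  · rintro ⟨c, hc⟩ i j
    simp only [hc, mul_div_cancel_right₀ _ (G.degree_pos _).ne']

theorem isStationary_iff (p : V → ℝ) : G.IsStationary p ↔ p = G.stationary := by
  rw [IsStationary, transitionMatrix_mulVec_eq_self_iff]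
  constructor
  · rintro ⟨⟨-, hsum⟩, c, hc⟩
    have hc' : ∀ i, p i = c * (2 * G.totalWeight) * G.stationary i := fun i => by
      rw [hc, mul_assoc, two_mul_totalWeight_mul_stationary]
    simp only [hc', ← Finset.mul_sum, sum_stationary, mul_one] at hsum
    ext i
    rw [hc', hsum, one_mul]
  · rintro rfl
    exact ⟨⟨G.stationary_nonneg, G.sum_stationary⟩, (2 * G.totalWeight)⁻¹, fun i =>
      div_eq_inv_mul _ _⟩

end Stationary

section MeanHittingTime

variable {V : Type*} [Fintype V] [DecidableEq V] (G : WeightedGraph V)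

/-- The expected time in which the random walk started at `i` reaches `j`, given by the closed
formula `2m (e_i - e_j)ᵀ Q† (π - e_j)`; `lintegral_hittingTime_walkLaw` shows that this is the
expectation of `hittingTime`. -/
noncomputable def meanHittingTime (i j : V) : ℝ :=
  2 * G.totalWeight * ((Pi.single i 1 - Pi.single j 1) ⬝ᵥ
    (moorePenroseInverse G.laplacian *ᵥ (G.stationary - Pi.single j 1)))

theorem meanHittingTime_self (j : V) : G.meanHittingTime j j = 0 := by
  simp [meanHittingTime]

theorem meanHittingTime_sub (i i' j : V) :
    G.meanHittingTime i j - G.meanHittingTime i' j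
      = 2 * G.totalWeight * ((Pi.single i 1 - Pi.single i' 1) ⬝ᵥ
        (moorePenroseInverse G.laplacian *ᵥ (G.stationary - Pi.single j 1))) := by
  rw [meanHittingTime, meanHittingTime, ← mul_sub, ← sub_dotProduct, sub_sub_sub_cancel_right]

theorem meanHittingTime_add_swap (i j : V) :
    G.meanHittingTime i j + G.meanHittingTime j i
      = 2 * G.totalWeight * G.effectiveResistance i j := by
  rw [meanHittingTime, meanHittingTime, ← neg_sub (Pi.single i 1), neg_dotProduct,
    ← mul_add, ← sub_eq_add_neg, ← dotProduct_sub, ← Matrix.mulVec_sub, sub_sub_sub_cancel_left]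
  rfl

variable [Nontrivial V]

theorem laplacian_mulVec_meanHittingTime (j : V) :
    G.laplacian *ᵥ (fun i => G.meanHittingTime i j)
      = (2 * G.totalWeight) • (G.stationary - Pi.single j 1) := by
  have hsum : ∑ i, (G.stationary - Pi.single j 1 : V → ℝ) i = 0 := by
    simp [Finset.sum_sub_distrib, sum_stationary]
  rw [← G.laplacian_mulVec_moorePenroseInverse_mulVec hsum]
  ext i
  simp only [Pi.smul_apply, smul_eq_mul, laplacian_mulVec_apply, meanHittingTime_sub,
    sub_dotProduct, single_one_dotProduct, Finset.mul_sum, mul_left_comm]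

theorem meanHittingTime_eq_one_add {i j : V} (hij : i ≠ j) :
    G.meanHittingTime i j = 1 + ∑ y, G.transitionMatrix y i * G.meanHittingTime y j := by
  have h := congrFun (G.laplacian_mulVec_meanHittingTime j) i
  rw [laplacian_mulVec_eq_degree_mul, Pi.smul_apply, Pi.sub_apply, Pi.single_eq_of_ne hij,
    sub_zero, smul_eq_mul, two_mul_totalWeight_mul_stationary] at h
  exact sub_eq_iff_eq_add.1 ((mul_eq_left₀ (G.degree_pos i).ne').1 h)

/-- By the one-step equation a minimum of `meanHittingTime · j` cannot be attained off `j`. -/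
theorem meanHittingTime_nonneg (i j : V) : 0 ≤ G.meanHittingTime i j := by
  obtain ⟨x, hx⟩ := Finite.exists_min fun i => G.meanHittingTime i j
  suffices h : x = j by simpa [h, meanHittingTime_self] using hx i
  by_contra hxj
  have hmin : G.meanHittingTime x j ≤ ∑ y, G.transitionMatrix y x * G.meanHittingTime y j := by
    calc G.meanHittingTime x j
        = ∑ y, G.transitionMatrix y x * G.meanHittingTime x j := by
          rw [← Finset.sum_mul, sum_transitionMatrix, one_mul]
      _ ≤ _ := Finset.sum_le_sum fun y _ =>
          mul_le_mul_of_nonneg_left (hx y) (G.transitionMatrix_nonneg x y)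
  linarith [G.meanHittingTime_eq_one_add hxj]

theorem sum_stationary_mul_meanHittingTime_eq (i i' : V) :
    ∑ j, G.stationary j * G.meanHittingTime i j
      = ∑ j, G.stationary j * G.meanHittingTime i' j := by
  have hmean : ∑ j, G.stationary j • (G.stationary - Pi.single j 1 : V → ℝ) = 0 := by
    ext x
    simp [Finset.sum_apply, mul_sub, Finset.sum_sub_distrib, ← Finset.sum_mul, sum_stationary,
      Pi.single_apply]
  rw [← sub_eq_zero, ← Finset.sum_sub_distrib]
  calc ∑ j, (G.stationary j * G.meanHittingTime i j - G.stationary j * G.meanHittingTime i' j)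
      = 2 * G.totalWeight * ((Pi.single i 1 - Pi.single i' 1) ⬝ᵥ
          (moorePenroseInverse G.laplacian *ᵥ
            ∑ j, G.stationary j • (G.stationary - Pi.single j 1 : V → ℝ))) := by
        simp only [← mul_sub, meanHittingTime_sub, Matrix.mulVec_sum, dotProduct_sum,
          Matrix.mulVec_smul, dotProduct_smul, smul_eq_mul, Finset.mul_sum, mul_left_comm]
    _ = 0 := by rw [hmean, Matrix.mulVec_zero, dotProduct_zero, mul_zero]

theorem sum_stationary_mul_meanHittingTime (i : V) :
    ∑ j, G.stationary j * G.meanHittingTime i j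
      = 2 * G.totalWeight * G.resistanceVariance G.stationary := by
  set π := G.stationary
  set κ := ∑ j, π j * G.meanHittingTime i j
  have haverage : ∑ x, ∑ y, π x * π y * G.meanHittingTime x y = κ := by
    calc ∑ x, ∑ y, π x * π y * G.meanHittingTime x y
        = ∑ x, π x * ∑ y, π y * G.meanHittingTime x y := by simp only [Finset.mul_sum, mul_assoc]
      _ = ∑ x, π x * κ := by simp only [π, κ, G.sum_stationary_mul_meanHittingTime_eq _ i]
      _ = κ := by rw [← Finset.sum_mul, G.sum_stationary, one_mul]
  have hswap : ∑ x, ∑ y, π x * π y * G.meanHittingTime y x = κ := by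
    rw [Finset.sum_comm, ← haverage]
    exact Finset.sum_congr rfl fun x _ => Finset.sum_congr rfl fun y _ => by
      rw [mul_comm (π y)]
  calc κ = (1 / 2) * (κ + κ) := by ring
    _ = (1 / 2) * ∑ x, ∑ y, π x * π y * (G.meanHittingTime x y + G.meanHittingTime y x) := by
        nth_rewrite 1 [← haverage]
        rw [← hswap]
        simp only [mul_add, Finset.sum_add_distrib]
    _ = 2 * G.totalWeight * G.resistanceVariance π := by
        simp only [meanHittingTime_add_swap, resistanceVariance_eq, Finset.mul_sum]
        exact Finset.sum_congr rfl fun x _ => Finset.sum_congr rfl fun y _ => by ring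

end MeanHittingTime

end WeightedGraph

theorem toENNReal_eq_tsum_ite_lt (N : ℕ∞) :
    (N : ℝ≥0∞) = ∑' t : ℕ, if (t : ℕ∞) < N then 1 else 0 := by
  induction N using ENat.recTopCoe with
  | top => simp
  | coe n =>
    rw [tsum_eq_sum (s := Finset.range n) fun t ht => if_neg (by simpa using ht)]
    simp [Finset.filter_true_of_mem]

theorem lintegral_toENNReal_eq_tsum_measure_lt {Ω : Type*} [MeasurableSpace Ω] (μ : Measure Ω)
    {τ : Ω → ℕ∞} (hτ : Measurable τ) :
    ∫⁻ ω, (τ ω : ℝ≥0∞) ∂μ = ∑' t : ℕ, μ {ω | (t : ℕ∞) < τ ω} := by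
  have hlt : ∀ t : ℕ, MeasurableSet {ω | (t : ℕ∞) < τ ω} := fun t =>
    hτ (.of_discrete (s := Set.Ioi (t : ℕ∞)))
  calc ∫⁻ ω, (τ ω : ℝ≥0∞) ∂μ
      = ∫⁻ ω, ∑' t : ℕ, {ω | (t : ℕ∞) < τ ω}.indicator 1 ω ∂μ := by
        simp only [toENNReal_eq_tsum_ite_lt, Set.indicator_apply, Set.mem_ofPred_eq, Pi.one_apply]
    _ = ∑' t : ℕ, μ {ω | (t : ℕ∞) < τ ω} := by
        rw [lintegral_tsum fun t => (measurable_one.indicator (hlt t)).aemeasurable]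
        exact tsum_congr fun t => lintegral_indicator_one (hlt t)

theorem tsum_eq_of_eq_add_succ {a W : ℕ → ℝ≥0∞} {C : ℝ≥0∞} (hW : ∀ t, W t = a t + W (t + 1))
    (hC : C ≠ ⊤) (hWa : ∀ t, W t ≤ C * a t) (h0 : W 0 ≠ ⊤) : ∑' t, a t = W 0 := by
  have hpartial : ∀ n, ∑ t ∈ Finset.range n, a t + W n = W 0 := by
    intro n
    induction n with
    | zero => simp
    | succ n ih => rw [Finset.sum_range_succ, add_assoc, ← hW, ih]
  have hfinite : ∑' t, a t ≠ ⊤ := ne_top_of_le_ne_top h0 <|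
    ENNReal.tsum_le_of_sum_range_le fun n => hpartial n ▸ le_self_add
  have hWlim : Filter.Tendsto W Filter.atTop (nhds 0) := by
    refine tendsto_nhds_bot_mono' ?_ hWa
    simpa using ENNReal.Tendsto.const_mul
      (ENNReal.tendsto_atTop_zero_of_tsum_ne_top hfinite) (.inr hC)
  have hlim := (ENNReal.summable (f := a)).hasSum.tendsto_sum_nat.add hWlim
  simp only [hpartial, add_zero] at hlim
  exact (tendsto_nhds_unique tendsto_const_nhds hlim).symm

section HittingTime

variable {S : Type*}

theorem lt_hittingTime_iff {x : ℕ → S} {j : S} {t : ℕ} :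
    (t : ℕ∞) < hittingTime x j ↔ ∀ s ≤ t, x s ≠ j := by
  rw [← not_le]
  refine (not_congr (hittingAfter_le_iff (u := fun (t : ℕ) (y : ℕ → S) => y t) (s := {j})
    (n := 0) (i := t) (ω := x))).trans ?_
  simp

theorem lt_hittingTime_succ_iff {x : ℕ → S} {j : S} {t : ℕ} :
    ((t + 1 : ℕ) : ℕ∞) < hittingTime x j ↔ (t : ℕ∞) < hittingTime x j ∧ x (t + 1) ≠ j := by
  simp only [lt_hittingTime_iff, Nat.le_succ_iff, or_imp, forall_and, forall_eq]

theorem preimage_frestrictLe_forall_ne (j : S) (t : ℕ) :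
    Preorder.frestrictLe (π := fun _ => S) t ⁻¹' {y | ∀ s, y s ≠ j}
      = {x | (t : ℕ∞) < hittingTime x j} := by
  ext x
  simp [lt_hittingTime_iff]

theorem measurableSet_forall_ne {ι : Type*} [Countable ι] [MeasurableSpace S]
    [MeasurableSingletonClass S] (j : S) : MeasurableSet {y : ι → S | ∀ s, y s ≠ j} := by
  simp only [Set.ofPred_forall]
  exact .iInter fun s => (measurableSet_singleton j).compl.preimage (measurable_pi_apply s)

variable [MeasurableSpace S] [MeasurableSingletonClass S]

theorem measurableSet_lt_hittingTime (j : S) (t : ℕ) :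
    MeasurableSet {x : ℕ → S | (t : ℕ∞) < hittingTime x j} := by
  rw [← preimage_frestrictLe_forall_ne]
  exact (measurableSet_forall_ne j).preimage (by fun_prop)

theorem measurable_hittingTime (j : S) : Measurable fun x : ℕ → S => hittingTime x j := by
  have hlt := measurableSet_lt_hittingTime j
  refine ENat.measurable_iff.2 fun n => ?_
  cases n with
  | zero =>
    convert (hlt 0).compl using 1
    ext x
    simp
  | succ n =>
    convert (hlt n).diff (hlt (n + 1)) using 1
    ext x
    simp only [Set.mem_preimage, Set.mem_singleton_iff, Set.mem_sdiff, Set.mem_ofPred_eq, not_lt,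
      Nat.cast_add, Nat.cast_one, ← ENat.add_one_le_iff (ENat.natCast_ne_top n)]
    exact ⟨fun h => ⟨h.ge, h.le⟩, fun h => le_antisymm h.2 h.1⟩

end HittingTime

section MarkovChain

variable {S : Type*} [MeasurableSpace S] (κ : Kernel S S) [IsMarkovKernel κ] (μ₀ : Measure S)

/-- The law, on the space of trajectories, of the time-homogeneous Markov chain with initial law
`μ₀` and transition kernel `κ`. -/
noncomputable def markovChainLaw : Measure (ℕ → S) :=
  Kernel.trajMeasure (X := fun _ => S) μ₀ fun n =>
    κ.comap (fun h : (Finset.Iic n → S) => h ⟨n, Finset.mem_Iic.2 le_rfl⟩)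
      (measurable_pi_apply _)

instance [IsProbabilityMeasure μ₀] : IsProbabilityMeasure (markovChainLaw κ μ₀) := by
  unfold markovChainLaw
  infer_instance

theorem map_zero_markovChainLaw : (markovChainLaw κ μ₀).map (fun x => x 0) = μ₀ := by
  have hinit : (markovChainLaw κ μ₀).map (Preorder.frestrictLe 0)
      = μ₀.map (MeasurableEquiv.piUnique fun _ : Finset.Iic 0 => S).symm := by
    rw [markovChainLaw, Kernel.trajMeasure, Measure.map_comp _ _ (by fun_prop),
      Kernel.traj_map_frestrictLe, Kernel.partialTraj_self, Measure.id_comp]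
  have hmap := congrArg (Measure.map fun y => y ⟨0, Finset.mem_Iic.2 le_rfl⟩) hinit
  rw [Measure.map_map (measurable_pi_apply _) (by fun_prop),
    Measure.map_map (measurable_pi_apply _) (by fun_prop)] at hmap
  exact hmap.trans Measure.map_id

variable [IsProbabilityMeasure μ₀]

variable {κ μ₀} in
theorem setLIntegral_succ_markovChainLaw {t : ℕ} {B : Set (Finset.Iic t → S)}
    (hB : MeasurableSet B) {g : S → ℝ≥0∞} (hg : Measurable g) :
    ∫⁻ x in Preorder.frestrictLe t ⁻¹' B, g (x (t + 1)) ∂(markovChainLaw κ μ₀)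
      = ∫⁻ x in Preorder.frestrictLe t ⁻¹' B, ∫⁻ y, g y ∂(κ (x t)) ∂(markovChainLaw κ μ₀) := by
  set P := markovChainLaw κ μ₀
  set last : (Finset.Iic t → S) → S := fun h => h ⟨t, Finset.mem_Iic.2 le_rfl⟩
  have hlast : Measurable last := measurable_pi_apply _
  have hmarkov : P.map (Preorder.frestrictLe t) ⊗ₘ κ.comap last hlast
      = P.map fun x => (Preorder.frestrictLe t x, x (t + 1)) :=
    Kernel.map_frestrictLe_trajMeasure_compProd_eq_map_trajMeasure (X := fun _ => S)
  calc ∫⁻ x in Preorder.frestrictLe t ⁻¹' B, g (x (t + 1)) ∂P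
      = ∫⁻ z in B ×ˢ Set.univ, g z.2 ∂(P.map fun x => (Preorder.frestrictLe t x, x (t + 1))) := by
        rw [setLIntegral_map (hB.prod .univ) (by fun_prop) (by fun_prop), Set.mk_preimage_prod,
          Set.preimage_univ, Set.inter_univ]
    _ = ∫⁻ h in B, ∫⁻ y, g y ∂(κ (last h)) ∂(P.map (Preorder.frestrictLe t)) := by
        rw [← hmarkov, Measure.setLIntegral_compProd (by fun_prop) hB .univ]
        simp only [Measure.restrict_univ, Kernel.comap_apply]
    _ = ∫⁻ x in Preorder.frestrictLe t ⁻¹' B, ∫⁻ y, g y ∂(κ (x t)) ∂P :=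
        setLIntegral_map hB (hg.lintegral_kernel.comp hlast) (by fun_prop)

variable [MeasurableSingletonClass S] {κ} {g : S → ℝ≥0∞} {j : S}

theorem setLIntegral_lt_hittingTime_eq_add (hg : Measurable g) (hgj : g j = 0)
    (hstep : ∀ x ≠ j, g x = 1 + ∫⁻ y, g y ∂(κ x)) (t : ℕ) :
    ∫⁻ x in {x | (t : ℕ∞) < hittingTime x j}, g (x t) ∂(markovChainLaw κ μ₀)
      = markovChainLaw κ μ₀ {x | (t : ℕ∞) < hittingTime x j}
        + ∫⁻ x in {x | ((t + 1 : ℕ) : ℕ∞) < hittingTime x j},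
            g (x (t + 1)) ∂(markovChainLaw κ μ₀) := by
  set P := markovChainLaw κ μ₀
  set E : ℕ → Set (ℕ → S) := fun t => {x | (t : ℕ∞) < hittingTime x j}
  have hE : ∀ t, MeasurableSet (E t) := measurableSet_lt_hittingTime j
  have hmarkov : ∫⁻ x in E t, ∫⁻ y, g y ∂(κ (x t)) ∂P = ∫⁻ x in E t, g (x (t + 1)) ∂P := by
    simp only [E, ← preimage_frestrictLe_forall_ne]
    exact (setLIntegral_succ_markovChainLaw (measurableSet_forall_ne j) hg).symm
  have hsurvive : ∫⁻ x in E t, g (x (t + 1)) ∂P = ∫⁻ x in E (t + 1), g (x (t + 1)) ∂P := by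
    classical
    rw [← lintegral_indicator (hE t), ← lintegral_indicator (hE (t + 1))]
    refine lintegral_congr fun x => ?_
    simp only [E, Set.indicator_apply, Set.mem_ofPred_eq, lt_hittingTime_succ_iff]
    by_cases hx : x (t + 1) = j <;> simp [hx, hgj]
  calc ∫⁻ x in E t, g (x t) ∂P
      = ∫⁻ x in E t, (1 + ∫⁻ y, g y ∂(κ (x t))) ∂P :=
        setLIntegral_congr_fun (hE t) fun x hx => hstep _ (lt_hittingTime_iff.1 hx t le_rfl)
    _ = P (E t) + ∫⁻ x in E t, ∫⁻ y, g y ∂(κ (x t)) ∂P := by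
        rw [lintegral_add_left measurable_const, setLIntegral_one]
    _ = P (E t) + ∫⁻ x in E (t + 1), g (x (t + 1)) ∂P := by rw [hmarkov, hsurvive]

/-- Boundedness of `g` singles out the expected hitting time among the solutions of the one-step
equation: the function which is `0` at `j` and `⊤` elsewhere is always one. -/
theorem lintegral_hittingTime_markovChainLaw (hg : Measurable g) (hgj : g j = 0)
    (hstep : ∀ x ≠ j, g x = 1 + ∫⁻ y, g y ∂(κ x)) {C : ℝ≥0∞} (hC : C ≠ ⊤) (hgC : ∀ x, g x ≤ C) :
    ∫⁻ x, (hittingTime x j : ℝ≥0∞) ∂(markovChainLaw κ μ₀) = ∫⁻ i, g i ∂μ₀ := by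
  set P := markovChainLaw κ μ₀
  have hstart : ∫⁻ x in {x | ((0 : ℕ) : ℕ∞) < hittingTime x j}, g (x 0) ∂P = ∫⁻ i, g i ∂μ₀ := by
    calc ∫⁻ x in {x | ((0 : ℕ) : ℕ∞) < hittingTime x j}, g (x 0) ∂P
        = ∫⁻ x, g (x 0) ∂P := by
          refine setLIntegral_eq_of_support_subset ?_
          intro x hx
          refine lt_hittingTime_iff.2 fun s hs hsj => hx ?_
          simp only [← Nat.le_zero.1 hs, hsj, hgj]
      _ = ∫⁻ i, g i ∂μ₀ := by
          rw [← lintegral_map hg (measurable_pi_apply 0), map_zero_markovChainLaw]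
  have hbound : ∀ t : ℕ, ∫⁻ x in {x | (t : ℕ∞) < hittingTime x j}, g (x t) ∂P
      ≤ C * P {x | (t : ℕ∞) < hittingTime x j} := fun t =>
    (lintegral_mono fun x : ℕ → S => hgC (x t)).trans_eq (setLIntegral_const _ C)
  rw [lintegral_toENNReal_eq_tsum_measure_lt P (measurable_hittingTime j), ← hstart]
  refine tsum_eq_of_eq_add_succ (setLIntegral_lt_hittingTime_eq_add μ₀ hg hgj hstep) hC hbound ?_
  exact ne_top_of_le_ne_top (ENNReal.mul_ne_top hC (measure_ne_top P _)) (hbound 0)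

end MarkovChain

theorem lintegral_ofReal_sum_smul_dirac {ι : Type*} [Fintype ι] [MeasurableSpace ι]
    [MeasurableSingletonClass ι] {p g : ι → ℝ} (hp : ∀ i, 0 ≤ p i) (hg : ∀ i, 0 ≤ g i) :
    ∫⁻ i, ENNReal.ofReal (g i) ∂(∑ i, ENNReal.ofReal (p i) • Measure.dirac i)
      = ENNReal.ofReal (∑ i, p i * g i) := by
  simp only [lintegral_finsetSum_measure, lintegral_smul_measure, lintegral_dirac, smul_eq_mul,
    ← ENNReal.ofReal_mul (hp _)]
  exact (ENNReal.ofReal_sum_of_nonneg fun i _ => mul_nonneg (hp i) (hg i)).symm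

namespace WeightedGraph

variable {V : Type*} [Fintype V] [DecidableEq V] [Nontrivial V] [MeasurableSpace V]
  [DiscreteMeasurableSpace V] (G : WeightedGraph V)

theorem lintegral_hittingTime_walkLaw (i j : V) :
    ∫⁻ x, (hittingTime x j : ℝ≥0∞) ∂(G.walkLaw i) = ENNReal.ofReal (G.meanHittingTime i j) := by
  have hstep : ∀ x ≠ j, ENNReal.ofReal (G.meanHittingTime x j)
      = 1 + ∫⁻ y, ENNReal.ofReal (G.meanHittingTime y j) ∂(G.stepKernel x) := by
    intro x hx
    have hsum : 0 ≤ ∑ y, G.transitionMatrix y x * G.meanHittingTime y j :=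
      Finset.sum_nonneg fun y _ =>
        mul_nonneg (G.transitionMatrix_nonneg x y) (G.meanHittingTime_nonneg y j)
    rw [G.meanHittingTime_eq_one_add hx, ENNReal.ofReal_add zero_le_one hsum, ENNReal.ofReal_one,
      ← lintegral_ofReal_sum_smul_dirac (G.transitionMatrix_nonneg x)
        (G.meanHittingTime_nonneg · j)]
    rfl
  obtain ⟨z, hz⟩ := Finite.exists_max fun x => ENNReal.ofReal (G.meanHittingTime x j)
  calc ∫⁻ x, (hittingTime x j : ℝ≥0∞) ∂(G.walkLaw i)
      = ∫⁻ x, ENNReal.ofReal (G.meanHittingTime x j) ∂(Measure.dirac i) :=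
        lintegral_hittingTime_markovChainLaw (κ := G.stepKernel) _ .of_discrete
          (by simp [meanHittingTime_self]) hstep ENNReal.ofReal_ne_top hz
    _ = ENNReal.ofReal (G.meanHittingTime i j) := lintegral_dirac _ _

theorem kemenyTime_eq (i : V) :
    G.kemenyTime i = ENNReal.ofReal (∑ j, G.stationary j * G.meanHittingTime i j) := by
  have hmeas : Measurable fun z : (ℕ → V) × V => (hittingTime z.1 z.2 : ℝ≥0∞) :=
    measurable_from_prod_countable_left fun j => Measurable.of_discrete.comp
      (measurable_hittingTime j)
  have : IsFiniteMeasure G.stationaryLaw := ⟨by simp [stationaryLaw]⟩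
  have : SFinite (G.walkLaw i) := inferInstanceAs (SFinite (markovChainLaw _ _))
  calc G.kemenyTime i
      = ∫⁻ j, ∫⁻ x, (hittingTime x j : ℝ≥0∞) ∂(G.walkLaw i) ∂G.stationaryLaw :=
        lintegral_prod_symm _ hmeas.aemeasurable
    _ = ∫⁻ j, ENNReal.ofReal (G.meanHittingTime i j) ∂G.stationaryLaw := by
        simp only [lintegral_hittingTime_walkLaw]
    _ = _ := lintegral_ofReal_sum_smul_dirac G.stationary_nonneg (G.meanHittingTime_nonneg i)

end WeightedGraph

theorem mainTheorem10 {V : Type*} [Fintype V] [DecidableEq V] [Nontrivial V]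
    [MeasurableSpace V] [DiscreteMeasurableSpace V] (G : WeightedGraph V) :
    (∀ p : V → ℝ, G.IsStationary p ↔ p = G.stationary) ∧
      ∀ i : V, G.kemenyTime i ≠ ⊤ ∧
        (G.kemenyTime i).toReal = 2 * G.totalWeight * G.resistanceVariance G.stationary := by
  refine ⟨G.isStationary_iff, fun i => ?_⟩
  rw [G.kemenyTime_eq, ← G.sum_stationary_mul_meanHittingTime i]
  exact ⟨ENNReal.ofReal_ne_top, ENNReal.toReal_ofReal <| Finset.sum_nonneg fun j _ =>
    mul_nonneg (G.stationary_nonneg j) (G.meanHittingTime_nonneg i j)⟩
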